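/- \textbf{Theorem 3 (strengthened information causality).} Let $a=(a_1,\dots,a_N)$ be random bits, $a_i\in\{1,-1\}$, such that every $a_i$ is uniformly distributed and $a_i,a_j$ are independent whenever $i\neq j$ (nothing more is assumed about the joint distribution). Alice receives $a$. Alice and Bob share an arbitrary state $\rho$, independent of $a$, of a bipartite quantum system $H_A\otimes H_B$ ($H_A$, $H_B$ complex Hilbert spaces of arbitrary, possibly infinite, dimension). Depending on $a$, Alice makes a two-outcome measurement $(E^{a}_{m})_{m=\pm1}$ on her system and sends the outcome $m\in\{1,-1\}$, a single classical bit, to Bob. Bob, asked to guess the $i$-th bit, makes a two-outcome measurement $(F^{i,m}_{\beta})_{\beta=\pm1}$ on his system, which may depend on $i$ and $m$, and outputs the outcome $b_i$ as his guess, so that $$P(b_i=\beta\mid a)=\sum_{m=\pm1}\operatorname{tr}\bigl(\rho\,(E^{a}_{m}\otimes F^{i,m}_{\beta})\bigr).$$ All measurements are general (positive operator valued). Then $$\sum_{i=1}^{N} I(a_i:b_i)\le 1,$$ where $I(a_i:b_i)=\sum_{\alpha,\beta}P(a_i=\alpha,b_i=\beta)\log_2\frac{P(a_i=\alpha,b_i=\beta)}{P(a_i=\alpha)P(b_i=\beta)}$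 is the mutual information in bits. -/

import Mathlib

open scoped TensorProduct BigOperators

noncomputable section

/-! A bit takes the two values `1` and `-1`, that is, it is an element of `ℤˣ`. -/

/-! ### Classical probability: the distribution of Alice's string, mutual information -/

/-- The mutual information, in bits, of two discrete random variables with joint distribution `P`,
`I = ∑ P(x,y) log₂ (P(x,y) / (P(x) P(y)))`. A term with `P(x,y) = 0` contributes `0`. -/
def mutualInfo {X Y : Type*} [Fintype X] [Fintype Y] (P : X → Y → ℝ) : ℝ :=
  ∑ x, ∑ y, P x y * Real.logb 2 (P x y / ((∑ y', P x y') * (∑ x', P x' y)))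

/-- The probability of the event `S` when Alice's string of `N` bits has the distribution `p`. -/
def eventProb {N : ℕ} (p : (Fin N → ℤˣ) → ℝ) (S : (Fin N → ℤˣ) → Prop) [DecidablePred S] : ℝ :=
  ∑ a, if S a then p a else 0

/-- Each single bit is uniformly distributed. -/
def UniformBits {N : ℕ} (p : (Fin N → ℤˣ) → ℝ) : Prop :=
  ∀ (i : Fin N) (α : ℤˣ), eventProb p (fun a => a i = α) = 1 / 2

/-- Any two different bits are independent. -/
def PairwiseIndepBits {N : ℕ} (p : (Fin N → ℤˣ) → ℝ) : Prop :=
  ∀ i j : Fin N, i ≠ j → ∀ α β : ℤˣ,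
    eventProb p (fun a => a i = α ∧ a j = β) =
      eventProb p (fun a => a i = α) * eventProb p (fun a => a j = β)

/-! ### Quantum mechanics -/

/-- A quantum measurement on the Hilbert space `H` with outcomes in `ι`
(a positive operator valued measure). -/
structure QMeasurement (ι : Type*) [Fintype ι] (H : Type*) [NormedAddCommGroup H]
    [InnerProductSpace ℂ H] where
  /-- the effect that belongs to an outcome -/
  effect : ι → H →L[ℂ] H
  isPositive : ∀ x, (effect x).IsPositive
  sum_effect : ∑ x, effect x = 1

/-- The Hilbert space tensor product: the completion of the algebraic tensor product with
`⟪a ⊗ b, c ⊗ d⟫ = ⟪a, c⟫ ⟪b, d⟫`. -/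
abbrev HTensor (HA HB : Type*) [NormedAddCommGroup HA] [InnerProductSpace ℂ HA]
    [NormedAddCommGroup HB] [InnerProductSpace ℂ HB] : Type _ :=
  UniformSpace.Completion (HA ⊗[ℂ] HB)

/-- The bounded operator `E ⊗ F` on the Hilbert space tensor product. -/
def tensorOp {HA HB : Type*} [NormedAddCommGroup HA] [InnerProductSpace ℂ HA]
    [NormedAddCommGroup HB] [InnerProductSpace ℂ HB] (E : HA →L[ℂ] HA) (F : HB →L[ℂ] HB) :
    HTensor HA HB →L[ℂ] HTensor HA HB :=
  (TensorProduct.mapL E F).completion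

/-- A bipartite, pure or mixed, state. The density operator is `ρ = ∑ₖ |ψₖ⟩⟨ψₖ|` with
`tr ρ = ∑ₖ ‖ψₖ‖² = 1`; every positive operator of trace one has this form (spectral theorem), and
a sequence `ψ` with at most one nonzero member is a pure state. -/
structure BipartiteState (HA HB : Type*) [NormedAddCommGroup HA] [InnerProductSpace ℂ HA]
    [NormedAddCommGroup HB] [InnerProductSpace ℂ HB] where
  /-- the unnormalized vectors `ψₖ` of an ensemble decomposition of `ρ` -/
  vec : ℕ → HTensor HA HB
  hasSum_norm_sq : HasSum (fun k => ‖vec k‖ ^ 2) 1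

/-- `tr (ρ (E ⊗ F)) = ∑ₖ ⟪ψₖ, (E ⊗ F) ψₖ⟫`: the probability that the local effects `E` and `F` both
occur. The series converges absolutely, and its terms are real for positive `E` and `F`. -/
def BipartiteState.prob {HA HB : Type*} [NormedAddCommGroup HA] [InnerProductSpace ℂ HA]
    [NormedAddCommGroup HB] [InnerProductSpace ℂ HB] (ρ : BipartiteState HA HB)
    (E : HA →L[ℂ] HA) (F : HB →L[ℂ] HB) : ℝ :=
  ∑' k, (inner ℂ (ρ.vec k) (tensorOp E F (ρ.vec k))).re

/-! ### Protocols -/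

/-- A protocol for guessing one of Alice's `N` bits with shared entanglement and one bit of
classical communication from Alice to Bob. Local and shared randomness are covered, since states
may be mixed and measurements need not be projective. -/
structure OneBitProtocol (N : ℕ) (HA HB : Type*) [NormedAddCommGroup HA] [InnerProductSpace ℂ HA]
    [NormedAddCommGroup HB] [InnerProductSpace ℂ HB] where
  /-- the state that Alice and Bob share -/
  state : BipartiteState HA HB
  /-- Alice, holding the string `a`, measures her system; the outcome is the bit she sends -/
  alice : (Fin N → ℤˣ) → QMeasurement ℤˣ HA
  /-- Bob, asked for the bit with index `i` and having received `m`, measures his system;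
  the outcome is his guess `bᵢ` -/
  bob : Fin N → ℤˣ → QMeasurement ℤˣ HB

namespace OneBitProtocol

variable {N : ℕ} {HA HB : Type*} [NormedAddCommGroup HA] [InnerProductSpace ℂ HA]
  [NormedAddCommGroup HB] [InnerProductSpace ℂ HB]

/-- The probability that Bob, asked for the bit with index `i`, answers `β` when Alice holds `a`:
the sum over the messages `m` of the probability that Alice sends `m` and Bob then answers `β`. -/
def guessProb (π : OneBitProtocol N HA HB) (a : Fin N → ℤˣ) (i : Fin N) (β : ℤˣ) : ℝ :=
  ∑ m : ℤˣ, π.state.prob ((π.alice a).effect m) ((π.bob i m).effect β)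

/-- The joint distribution of Alice's bit `aᵢ` and Bob's guess `bᵢ`, when Alice's string has the
distribution `p`. -/
def jointDist (π : OneBitProtocol N HA HB) (p : (Fin N → ℤˣ) → ℝ) (i : Fin N) (α β : ℤˣ) : ℝ :=
  ∑ a, if a i = α then p a * π.guessProb a i β else 0

end OneBitProtocol

end

/-!
Write `s i = E bᵢ` and `d i = E aᵢ bᵢ`. Since `aᵢ` is uniform, the mutual information of `aᵢ` and
`bᵢ` is the mean over `bᵢ` of `1 - h(P(aᵢ | bᵢ))`, and the bound `1 - h((1 + x) / 2) ≤ x ^ 2` for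
the binary entropy turns it into `I(aᵢ : bᵢ) ≤ d i ^ 2 / (1 - s i ^ 2)`, the squared correlation
coefficient (`mutualInfo_le_sq_div`). It remains to show that these squares add up to at most `1`.

The string `a` and the message `m` steer Bob's system into the unnormalized state `σ a m`. Before
the message arrives Bob learns nothing, so `∑ m, σ a m = ρ` does not depend on `a`. Bob's guess has
the observables `B i m` with `-1 ≤ B i m ≤ 1`, and `d i = E aᵢ ∑ m, tr (σ a m * B i m)`. Take real
weights `c i` and put `W m a = ∑ i, c i * aᵢ • (B i m - s i)`. Uniform and pairwise independent bits
are orthonormal and orthogonal to constants in the `L²` space of the distribution of `a`. Hence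
`E W m a = 0`, and `E ∑ m, tr (S m * W m a ^ 2)` with `S m = E σ a m` is at most the weighted sum of
the variances of the `bᵢ`. For each `m` the matrix inequality `sq_sum_trace_le` gives
`(E tr (σ a m * W m a)) ^ 2 ≤ (tr ρ - tr (S m)) * E tr (S m * W m a ^ 2)`.
Its proof represents `tr (σ a m * ·)` in the inner product `tr (S m * (X * Y + Y * X)) / 2` by the
solution `L` of Lyapunov's equation `S m * L + L * S m = 2 σ a m`. The solution is positive, so that
`tr (L * σ a m) ≤ tr (L * ρ)`, and the mean of the right hand side is `tr ρ` because the solutions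
average to the identity; as `E W m a = 0`, one may subtract the identity from `L`, which lowers
`tr ρ` to `tr ρ - tr (S m)`. The factors of the two messages add up to `tr ρ`, and this is
where it matters that a single bit is sent. By Cauchy-Schwarz over `m` one obtains
`(∑ i, c i * d i) ^ 2 ≤ ∑ i, c i ^ 2 * (1 - s i ^ 2)`, and `c i = d i / (1 - s i ^ 2)` finishes the
proof.

The matrices come from an algebraic tensor `∑ j, x j ⊗ y j` with orthonormal `y j`. Both sides of the
covariance inequality are continuous in the state vector, so it passes to the completed tensor
product, and by Cauchy-Schwarz it passes to mixtures of vectors (`BipartiteState.sq_sum_cov_prob_le`).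
-/

/-! ### A quadratic bound for the binary entropy -/

lemma hasSum_mul_log_add_mul_log {x : ℝ} (hx : |x| < 1) :
    HasSum (fun k : ℕ => (x ^ 2) ^ (k + 1) * (1 / (((k : ℝ) + 1) * (2 * k + 1))))
      ((1 + x) * Real.log (1 + x) + (1 - x) * Real.log (1 - x)) := by
  have h1 := (Real.hasSum_log_sub_log_of_abs_lt_one hx).mul_left x
  have hx2 : |x ^ 2| < 1 := by rw [abs_pow]; exact pow_lt_one₀ (abs_nonneg x) hx two_ne_zero
  have h2 := Real.hasSum_pow_div_log_of_abs_lt_one hx2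
  obtain ⟨ha, hb⟩ := abs_lt.1 hx
  have h3 := h1.sub h2
  have e : x * (Real.log (1 + x) - Real.log (1 - x)) - -Real.log (1 - x ^ 2)
      = (1 + x) * Real.log (1 + x) + (1 - x) * Real.log (1 - x) := by
    have : (1 : ℝ) - x ^ 2 = (1 + x) * (1 - x) := by ring
    rw [this, Real.log_mul (by linarith) (by linarith)]
    ring
  rw [e] at h3
  convert! h3 using 2 with k
  have h1 : (k : ℝ) + 1 ≠ 0 := by positivity
  have h2 : 2 * (k : ℝ) + 1 ≠ 0 := by positivity
  field_simp
  ring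

/-- All coefficients of the power series in `x ^ 2` are nonnegative, so its quotient by `x ^ 2` is
monotone; its limit at `x = 1` is `2 log 2`. -/
lemma mul_log_add_mul_log_le {x : ℝ} (hx : |x| ≤ 1) :
    (1 + x) * Real.log (1 + x) + (1 - x) * Real.log (1 - x) ≤ x ^ 2 * (2 * Real.log 2) := by
  have key : ∀ y : ℝ, |x| < 1 → 0 < y → y < 1 → |x| ≤ y →
    ((1 + x) * Real.log (1 + x) + (1 - x) * Real.log (1 - x)) * y ^ 2 ≤
      x ^ 2 * ((1 + y) * Real.log (1 + y) + (1 - y) * Real.log (1 - y)) := by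
    intro y hx hy0 hy1 hxy
    have h1 := (hasSum_mul_log_add_mul_log hx).mul_right (y ^ 2)
    have h2 := (hasSum_mul_log_add_mul_log (x := y) (by rwa [abs_of_pos hy0])).mul_left (x ^ 2)
    refine hasSum_le (fun k => ?_) h1 h2
    have hsq : x ^ 2 ≤ y ^ 2 := by rw [← sq_abs x]; gcongr
    have : (x ^ 2) ^ k ≤ (y ^ 2) ^ k := by gcongr
    have hc : 0 ≤ 1 / (((k : ℝ) + 1) * (2 * k + 1)) * (x ^ 2 * y ^ 2) := by positivity
    calc _ = (1 / (((k : ℝ) + 1) * (2 * k + 1)) * (x ^ 2 * y ^ 2)) * (x ^ 2) ^ k := by ring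
      _ ≤ (1 / (((k : ℝ) + 1) * (2 * k + 1)) * (x ^ 2 * y ^ 2)) * (y ^ 2) ^ k := by gcongr
      _ = _ := by ring
  rcases hx.lt_or_eq with hlt | heq
  · have hcont : Continuous fun y : ℝ =>
        x ^ 2 * ((1 + y) * Real.log (1 + y) + (1 - y) * Real.log (1 - y)) := by
      have := Real.continuous_mul_log
      exact continuous_const.mul ((this.comp (continuous_const.add continuous_id)).add
        (this.comp (continuous_const.sub continuous_id)))
    have hl := (hcont.tendsto 1).mono_left (nhdsWithin_le_nhds (s := Set.Iio 1))
    have hl' : Filter.Tendsto (fun y : ℝ =>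
        ((1 + x) * Real.log (1 + x) + (1 - x) * Real.log (1 - x)) * y ^ 2)
        (nhdsWithin 1 (Set.Iio 1))
        (nhds (((1 + x) * Real.log (1 + x) + (1 - x) * Real.log (1 - x)) * 1 ^ 2)) :=
      ((continuous_const.mul (continuous_pow 2)).tendsto 1).mono_left nhdsWithin_le_nhds
    have hev : ∀ᶠ y : ℝ in nhdsWithin 1 (Set.Iio 1), max |x| (1 / 2) < y ∧ y < 1 :=
      Filter.Eventually.and
        (nhdsWithin_le_nhds (lt_mem_nhds (max_lt hlt (by norm_num)))) self_mem_nhdsWithin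
    have := le_of_tendsto_of_tendsto hl' hl (hev.mono fun y hy =>
      key y hlt (by have := (le_max_right |x| (1/2)).trans_lt hy.1; linarith) hy.2
        ((le_max_left _ _).trans hy.1.le))
    norm_num at this
    linarith
  · rcases eq_or_eq_neg_of_abs_eq heq with rfl | rfl <;> norm_num

/-- The bound `1 - h((1 + x) / 2) ≤ x ^ 2` for the binary entropy `h`. -/
lemma mul_logb_add_mul_logb_le {x : ℝ} (hx : |x| ≤ 1) :
    (1 + x) * Real.logb 2 (1 + x) + (1 - x) * Real.logb 2 (1 - x) ≤ 2 * x ^ 2 := by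
  have h2 : 0 < Real.log 2 := Real.log_pos one_lt_two
  have := mul_log_add_mul_log_le hx
  simp only [Real.logb]
  rw [mul_div_assoc', mul_div_assoc', ← add_div, div_le_iff₀ h2]
  linarith

/-! ### Lyapunov's equation for positive matrices -/

section Matrices

open Matrix
open scoped ComplexOrder

variable {n : Type*} [Fintype n]

lemma Matrix.PosSemidef.exists_eq_conjTranspose_mul_self [DecidableEq n] {P : Matrix n n ℂ} (hP : P.PosSemidef) :
    ∃ C : Matrix n n ℂ, P = Cᴴ * C := by
  open scoped MatrixOrder in
  exact CStarAlgebra.nonneg_iff_eq_star_mul_self.1 (Matrix.nonneg_iff_posSemidef.2 hP)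

lemma Matrix.PosSemidef.re_trace_nonneg {P : Matrix n n ℂ} (hP : P.PosSemidef) :
    0 ≤ P.trace.re :=
  (Complex.le_def.1 hP.trace_nonneg).1

lemma Matrix.PosSemidef.re_trace_mul_nonneg [DecidableEq n] {P Q : Matrix n n ℂ} (hP : P.PosSemidef)
    (hQ : Q.PosSemidef) : 0 ≤ (P * Q).trace.re := by
  obtain ⟨C, rfl⟩ := hP.exists_eq_conjTranspose_mul_self
  rw [mul_assoc, trace_mul_comm]
  exact (hQ.mul_mul_conjTranspose_same C).re_trace_nonneg

lemma Matrix.PosDef.eq_zero_of_lyapunov [DecidableEq n] {S X : Matrix n n ℂ} (hS : S.PosDef)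
    (h : S * X + X * S = 0) : X = 0 := by
  have h1 : (Xᴴ * S * X).PosSemidef := hS.posSemidef.conjTranspose_mul_mul_same X
  have h2 : (X * S * Xᴴ).PosSemidef := hS.posSemidef.mul_mul_conjTranspose_same X
  have h3 : (Xᴴ * S * X).trace + (X * S * Xᴴ).trace = 0 := by
    rw [trace_mul_comm (X * S), ← trace_add, mul_assoc, ← mul_add, h, mul_zero, trace_zero]
  have h4 : (Xᴴ * S * X).trace = 0 :=
    le_antisymm (by rw [eq_neg_of_add_eq_zero_left h3]; exact neg_nonpos.2 h2.trace_nonneg)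
      h1.trace_nonneg
  have h5 := h1.trace_eq_zero_iff.1 h4
  refine Matrix.ext_of_mulVec_single fun i => ?_
  rw [zero_mulVec]
  by_contra hne
  have := hS.dotProduct_mulVec_pos hne
  rw [star_mulVec, ← dotProduct_mulVec, mulVec_mulVec, mulVec_mulVec, h5] at this
  simp at this

/-- Lyapunov's theorem: for positive definite `S` and positive semidefinite `P` the equation
`S L + L S = 2 P` has a positive semidefinite solution. If `v` is an eigenvector of `L` with
eigenvalue `l`, the equation gives `l ⟪v, S v⟫ = ⟪v, P v⟫`, which forces `l ≥ 0`. -/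
lemma Matrix.PosDef.exists_posSemidef_lyapunov [DecidableEq n] {S P : Matrix n n ℂ} (hS : S.PosDef)
    (hP : P.PosSemidef) : ∃ L : Matrix n n ℂ, L.PosSemidef ∧ S * L + L * S = P + P := by
  let f : Matrix n n ℂ →ₗ[ℂ] Matrix n n ℂ := LinearMap.mulLeft ℂ S + LinearMap.mulRight ℂ S
  have hinj : Function.Injective f := by
    rw [← LinearMap.ker_eq_bot, LinearMap.ker_eq_bot']
    exact fun X hX => hS.eq_zero_of_lyapunov hX
  obtain ⟨L, hL⟩ := LinearMap.injective_iff_surjective.1 hinj (P + P)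
  have hL' : S * L + L * S = P + P := hL
  have hherm : L.IsHermitian := by
    apply hinj
    rw [hL]
    have := congrArg (fun M : Matrix n n ℂ => Mᴴ) hL'
    rw [conjTranspose_add, conjTranspose_mul, conjTranspose_mul, conjTranspose_add,
      hS.isHermitian.eq, hP.isHermitian.eq, add_comm] at this
    exact this
  refine ⟨L, hherm.posSemidef_iff_eigenvalues_nonneg.2 fun i => ?_, hL'⟩
  set v := (hherm.eigenvectorBasis i).ofLp with hv
  have hLv : L *ᵥ v = hherm.eigenvalues i • v := hherm.mulVec_eigenvectorBasis i
  have hv0 : v ≠ 0 := fun h => hherm.eigenvectorBasis.orthonormal.ne_zero i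
    (by ext j; simpa [hv] using congrFun h j)
  have h1 := hS.dotProduct_mulVec_pos hv0
  have h2 := hP.dotProduct_mulVec_nonneg v
  have hvL : star v ᵥ* L = hherm.eigenvalues i • star v := by
    have := congrArg star hLv
    rw [star_mulVec, hherm.eq] at this
    rw [this]; ext; simp
  have h3 : star v ⬝ᵥ ((S * L + L * S) *ᵥ v)
      = 2 * (hherm.eigenvalues i : ℂ) * (star v ⬝ᵥ (S *ᵥ v)) := by
    rw [add_mulVec, ← mulVec_mulVec, ← mulVec_mulVec, hLv, dotProduct_add,
      dotProduct_mulVec _ L, hvL, mulVec_smul, dotProduct_smul, smul_dotProduct]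
    simp only [Complex.real_smul]
    ring
  rw [hL', add_mulVec, dotProduct_add] at h3
  obtain ⟨h1re, h1im⟩ := Complex.lt_def.1 h1
  have h2re := (Complex.le_def.1 h2).1
  have h4 := congrArg Complex.re h3
  have : (2 * (hherm.eigenvalues i : ℂ) * (star v ⬝ᵥ (S *ᵥ v))).re
      = 2 * hherm.eigenvalues i * (star v ⬝ᵥ (S *ᵥ v)).re := by
    simp [Complex.mul_re]
  rw [this, Complex.add_re] at h4
  simp only [Complex.zero_re] at h1re h2re
  by_contra hneg
  push Not at hneg
  simp only [Pi.zero_apply] at hneg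
  nlinarith [mul_neg_of_neg_of_pos hneg h1re]

/-! ### The covariance inequality for a steered ensemble -/

/-- The quadratic form `tr (X * S * X)` at `X = L - 1 - l • W`, where `L` represents `P`. -/
lemma trace_quadratic [DecidableEq n] {S L P W : Matrix n n ℂ} (h : S * L + L * S = P + P) (l : ℝ) :
    ((L - 1 - l • W) * S * (L - 1 - l • W)).trace =
      (L * P).trace - 2 * P.trace + S.trace
        - 2 * l * ((P * W).trace - (S * W).trace) + l ^ 2 * (S * (W * W)).trace := by
  have e1 : (L * S * L).trace = (L * P).trace := by
    have := congrArg (fun M => (L * M).trace) h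
    simp only [mul_add, trace_add] at this
    have h2 : (L * (L * S)).trace = (L * S * L).trace := trace_mul_comm _ _
    rw [h2, ← mul_assoc] at this
    linear_combination this / 2
  have e2 : (L * S).trace = P.trace := by
    have := congrArg trace h
    rw [trace_add, trace_add, trace_mul_comm S L] at this
    linear_combination this / 2
  have e3 : (L * S * W).trace + (W * S * L).trace = 2 * (P * W).trace := by
    have := congrArg (fun M => (M * W).trace) h
    simp only [add_mul, trace_add] at this
    have h2 : (W * S * L).trace = (S * L * W).trace := by
      rw [mul_assoc, trace_mul_comm]
    rw [h2]
    linear_combination this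
  have e4 : (W * S * W).trace = (S * (W * W)).trace := by
    rw [mul_assoc, trace_mul_comm, mul_assoc]
  have e5 : (W * S).trace = (S * W).trace := trace_mul_comm _ _
  have e6 : (S * L).trace = P.trace := by rw [trace_mul_comm, e2]
  simp only [sub_mul, mul_sub, trace_sub, smul_mul_assoc, mul_smul_comm, trace_smul, one_mul,
    mul_one, e1, e2, e4, e5, e6, Complex.real_smul]
  linear_combination -(l : ℂ) * e3

variable {A : Type*} [Fintype A]

lemma re_trace_sum_smul (p : A → ℝ) (M : A → Matrix n n ℂ) :
    (∑ a, p a • M a).trace.re = ∑ a, p a * (M a).trace.re := by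
  simp [trace_sum, trace_smul]

lemma sq_sum_trace_le_of_posDef [DecidableEq n] {p : A → ℝ} (hp : ∀ a, 0 ≤ p a) (hp1 : ∑ a, p a = 1)
    {σ W : A → Matrix n n ℂ} {ρ S : Matrix n n ℂ} (hS : S = ∑ a, p a • σ a) (hpos : S.PosDef)
    (hσ : ∀ a, (σ a).PosSemidef) (hρ : ∀ a, (ρ - σ a).PosSemidef)
    (hW : ∀ a, (W a).IsHermitian) (hW0 : ∑ a, p a • W a = 0) :
    (∑ a, p a * (σ a * W a).trace.re) ^ 2 ≤
      (ρ.trace.re - S.trace.re) * ∑ a, p a * (S * (W a * W a)).trace.re := by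
  choose L hL hLeq using fun a => hpos.exists_posSemidef_lyapunov (hσ a)
  have hLsum : ∑ a, p a • L a = 1 := by
    refine sub_eq_zero.1 (hpos.eq_zero_of_lyapunov ?_)
    have : S * (∑ a, p a • L a) + (∑ a, p a • L a) * S = S + S := by
      rw [Finset.mul_sum, Finset.sum_mul, ← Finset.sum_add_distrib]
      conv_rhs => rw [hS, ← Finset.sum_add_distrib]
      refine Finset.sum_congr rfl fun a _ => ?_
      rw [mul_smul_comm, smul_mul_assoc, ← smul_add, hLeq, smul_add]
    rw [mul_sub, sub_mul, mul_one, one_mul, sub_add_sub_comm, this, sub_self]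
  have hSW : ∑ a, p a * (S * W a).trace.re = 0 := by
    have := re_trace_sum_smul p (fun a => S * W a)
    simp only [← mul_smul_comm, ← Finset.mul_sum, hW0, mul_zero, trace_zero] at this
    simpa using this.symm
  have htr : ∑ a, p a * (σ a).trace.re = S.trace.re := by rw [hS, re_trace_sum_smul]
  have hLρ : ∑ a, p a * (L a * ρ).trace.re = ρ.trace.re := by
    have := re_trace_sum_smul p (fun a => L a * ρ)
    simp only [← smul_mul_assoc, ← Finset.sum_mul, hLsum, one_mul] at this
    exact this.symm
  have hLσ : ∑ a, p a * (L a * σ a).trace.re ≤ ρ.trace.re := by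
    rw [← hLρ]
    refine Finset.sum_le_sum fun a _ => mul_le_mul_of_nonneg_left ?_ (hp a)
    have := (hL a).re_trace_mul_nonneg (hρ a)
    rw [mul_sub, trace_sub, Complex.sub_re] at this
    linarith
  have key : ∀ l : ℝ, 0 ≤ (∑ a, p a * (S * (W a * W a)).trace.re) * (l * l)
      + (-2 * ∑ a, p a * (σ a * W a).trace.re) * l + (ρ.trace.re - S.trace.re) := by
    intro l
    have h0 : 0 ≤ ∑ a, p a * ((L a - 1 - l • W a) * S * (L a - 1 - l • W a)).trace.re := by
      refine Finset.sum_nonneg fun a _ => mul_nonneg (hp a) ?_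
      have hh : (L a - 1 - l • W a).IsHermitian :=
        ((hL a).isHermitian.sub isHermitian_one).sub (by
          rw [IsHermitian, conjTranspose_smul, (hW a).eq]; simp)
      have := (hpos.posSemidef.conjTranspose_mul_mul_same (L a - 1 - l • W a)).re_trace_nonneg
      rwa [hh.eq] at this
    have h1 : ∀ a, ((L a - 1 - l • W a) * S * (L a - 1 - l • W a)).trace.re =
        (L a * σ a).trace.re - 2 * (σ a).trace.re + S.trace.re
        - 2 * l * ((σ a * W a).trace.re - (S * W a).trace.re)
        + l ^ 2 * (S * (W a * W a)).trace.re := by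
      intro a
      rw [trace_quadratic (hLeq a) l]
      simp [← Complex.ofReal_pow, Complex.mul_re]
    have h2 : ∑ a, p a * ((L a - 1 - l • W a) * S * (L a - 1 - l • W a)).trace.re =
        ∑ a, p a * (L a * σ a).trace.re - 2 * ∑ a, p a * (σ a).trace.re
        + (∑ a, p a) * S.trace.re
        - 2 * l * (∑ a, p a * (σ a * W a).trace.re - ∑ a, p a * (S * W a).trace.re)
        + l ^ 2 * ∑ a, p a * (S * (W a * W a)).trace.re := by
      simp only [h1, Finset.mul_sum, Finset.sum_mul, ← Finset.sum_add_distrib,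
        ← Finset.sum_sub_distrib]
      exact Finset.sum_congr rfl fun a _ => by ring
    rw [h2, hSW, htr, hp1] at h0
    linarith
  have := discrim_le_zero key
  rw [discrim] at this
  linarith

/-- Quantum steering against pairwise correlations. Let `σ a` be positive matrices below `ρ` with
mean `S`, and let `W a` be observables of mean zero. Then the mean of `tr (σ a * W a)` is controlled
by the mean of `tr (S * W a ^ 2)`. It is the Cauchy-Schwarz inequality for the symmetrized inner
product `⟪X, Y⟫ = tr (S * (X * Y + Y * X)) / 2`: the vector that represents `tr (σ a * ·)` is the
solution `L a` of Lyapunov's equation, and `tr (L a * σ a) ≤ tr (L a * ρ)` because `L a` is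
positive. -/
lemma sq_sum_trace_le [DecidableEq n] {p : A → ℝ} (hp : ∀ a, 0 ≤ p a) (hp1 : ∑ a, p a = 1)
    {σ W : A → Matrix n n ℂ} {ρ S : Matrix n n ℂ} (hS : S = ∑ a, p a • σ a)
    (hσ : ∀ a, (σ a).PosSemidef) (hρ : ∀ a, (ρ - σ a).PosSemidef)
    (hW : ∀ a, (W a).IsHermitian) (hW0 : ∑ a, p a • W a = 0) :
    (∑ a, p a * (σ a * W a).trace.re) ^ 2 ≤
      (ρ.trace.re - S.trace.re) * ∑ a, p a * (S * (W a * W a)).trace.re := by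
  have hSpos : S.PosSemidef := by
    rw [hS]
    refine posSemidef_sum _ fun a _ => ?_
    have := (hσ a).smul (Complex.zero_le_real.2 (hp a))
    rwa [Complex.coe_smul] at this
  -- adding `ε • 1` to all states makes `S` positive definite
  have key : ∀ ε : ℝ, 0 < ε → (∑ a, p a * (σ a * W a).trace.re) ^ 2 ≤
      (ρ.trace.re - S.trace.re) * (∑ a, p a * (S * (W a * W a)).trace.re
        + ε * ∑ a, p a * (W a * W a).trace.re) := by
    intro ε hε
    have hε1 : ((ε : ℂ) • (1 : Matrix n n ℂ)).PosDef :=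
      PosDef.one.smul (Complex.zero_lt_real.2 hε)
    have hW0' : ∑ a, p a * (W a).trace.re = 0 := by
      rw [← re_trace_sum_smul, hW0]; simp
    have := sq_sum_trace_le_of_posDef hp hp1 (σ := fun a => σ a + (ε : ℂ) • 1)
      (ρ := ρ + (ε : ℂ) • 1) (S := S + (ε : ℂ) • 1) (W := W)
      (by simp only [smul_add, Finset.sum_add_distrib, ← Finset.sum_smul, hp1, one_smul, hS])
      (PosDef.posSemidef_add hSpos hε1) (fun a => (hσ a).add hε1.posSemidef)
      (fun a => by simpa using hρ a) hW hW0
    simp only [add_mul, smul_mul_assoc, one_mul, trace_add, trace_smul, smul_eq_mul,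
      Complex.add_re, Complex.re_ofReal_mul, mul_add, Finset.sum_add_distrib] at this
    have e : ∑ a, p a * (ε * (W a).trace.re) = 0 := by
      rw [← mul_zero ε, ← hW0', Finset.mul_sum]
      exact Finset.sum_congr rfl fun a _ => by ring
    have e' : ∑ a, p a * (ε * (W a * W a).trace.re) = ε * ∑ a, p a * (W a * W a).trace.re := by
      rw [Finset.mul_sum]
      exact Finset.sum_congr rfl fun a _ => by ring
    rw [e, e', add_zero, add_sub_add_right_eq_sub] at this
    linarith
  have hlim : Filter.Tendsto (fun ε : ℝ => (ρ.trace.re - S.trace.re) *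
      (∑ a, p a * (S * (W a * W a)).trace.re + ε * ∑ a, p a * (W a * W a).trace.re))
      (nhdsWithin 0 (Set.Ioi 0)) (nhds ((ρ.trace.re - S.trace.re) *
      (∑ a, p a * (S * (W a * W a)).trace.re + 0 * ∑ a, p a * (W a * W a).trace.re))) :=
    ((by fun_prop : Continuous _).tendsto 0).mono_left nhdsWithin_le_nhds
  have := ge_of_tendsto hlim (Filter.mem_of_superset self_mem_nhdsWithin fun ε hε => key ε hε)
  simpa using this

end Matrices

/-! ### The covariance inequality for a one-bit message -/

section Matrices

open Matrix
open scoped ComplexOrder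

variable {n : Type*} [Fintype n]

lemma one_sub_sq_posSemidef_of_add_eq_one [DecidableEq n] {P Q : Matrix n n ℂ}
    (hP : P.PosSemidef) (hQ : Q.PosSemidef) (h : P + Q = 1) :
    (1 - (P - Q) * (P - Q)).PosSemidef := by
  obtain rfl : Q = 1 - P := eq_sub_of_add_eq' h
  have h1 := hP.conjTranspose_mul_mul_same (1 - P)
  have h2 := hQ.conjTranspose_mul_mul_same P
  rw [hQ.isHermitian.eq] at h1
  rw [hP.isHermitian.eq] at h2
  have h3 := (h1.add h2).add (h1.add h2)
  -- `1 - (2P - 1)² = 4 P(1 - P)`, and `P(1 - P) = (1 - P)P(1 - P) + P(1 - P)P`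
  convert h3.add h3 using 1
  noncomm_ring

lemma re_trace_mul_sub_sq_le [DecidableEq n] {S B : Matrix n n ℂ} (hS : S.PosSemidef)
    (hB : (1 - B * B).PosSemidef) (s : ℝ) :
    (S * ((B - s • 1) * (B - s • 1))).trace.re ≤
      (1 + s ^ 2) * S.trace.re - 2 * s * (S * B).trace.re := by
  have h := hS.re_trace_mul_nonneg hB
  simp only [mul_sub, sub_mul, mul_one, one_mul, smul_mul_assoc, mul_smul_comm, trace_sub,
    trace_smul, Complex.sub_re, Complex.smul_re, smul_eq_mul] at h ⊢
  linarith

variable {A M ι : Type*} [Fintype A] [Fintype M] [Fintype ι] [DecidableEq ι]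

/-- The covariance inequality for a message with two values. The functions `g i` form an orthonormal
system of mean-zero functions of Alice's data `a`; `σ a m` is Bob's unnormalized state for the
message `m`, whose sum over `m` is the state `ρ` that he holds before the message arrives; `B i m`
is the observable that he measures. -/
lemma sq_sum_cov_le [DecidableEq n] {p : A → ℝ} (hp : ∀ a, 0 ≤ p a) (hp1 : ∑ a, p a = 1)
    {g : ι → A → ℝ} (hg0 : ∀ i, ∑ a, p a * g i a = 0)
    (hg : ∀ i j, ∑ a, p a * (g i a * g j a) = if i = j then 1 else 0)
    (hM : Fintype.card M = 2)
    {σ : A → M → Matrix n n ℂ} {ρ : Matrix n n ℂ} (hσ : ∀ a m, (σ a m).PosSemidef)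
    (hρ : ∀ a, ∑ m, σ a m = ρ) {B : ι → M → Matrix n n ℂ} (hB : ∀ i m, (B i m).IsHermitian)
    (hB1 : ∀ i m, (1 - B i m * B i m).PosSemidef) (c s : ι → ℝ) :
    (∑ i, c i * ∑ a, p a * g i a * ∑ m, (σ a m * B i m).trace.re) ^ 2 ≤
      ρ.trace.re * ∑ i, c i ^ 2 * ((1 + s i ^ 2) * ρ.trace.re
        - 2 * s i * ∑ a, p a * ∑ m, (σ a m * B i m).trace.re) := by
  set S : M → Matrix n n ℂ := fun m => ∑ a, p a • σ a m with hS
  set X : ι → M → Matrix n n ℂ := fun i m => B i m - s i • 1 with hX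
  set W : M → A → Matrix n n ℂ := fun m a => ∑ i, (c i * g i a) • X i m with hW
  have hSpos : ∀ m, (S m).PosSemidef := fun m => posSemidef_sum _ fun a _ => by
    have := (hσ a m).smul (Complex.zero_le_real.2 (hp a))
    rwa [Complex.coe_smul] at this
  have hXh : ∀ i m, (X i m).IsHermitian := fun i m =>
    (hB i m).sub (by rw [IsHermitian, conjTranspose_smul]; simp)
  have hWh : ∀ m a, (W m a).IsHermitian := fun m a => by
    simp [IsHermitian, hW, conjTranspose_sum, conjTranspose_smul, (hXh _ _).eq]
  have hW0 : ∀ m, ∑ a, p a • W m a = 0 := fun m => by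
    simp only [hW, Finset.smul_sum, smul_smul]
    rw [Finset.sum_comm]
    refine Finset.sum_eq_zero fun i _ => ?_
    rw [← Finset.sum_smul]
    have : ∑ a, p a * (c i * g i a) = 0 := by
      rw [← mul_zero (c i), ← hg0 i, Finset.mul_sum]
      exact Finset.sum_congr rfl fun a _ => by ring
    rw [this, zero_smul]
  have hle : ∀ m a, (ρ - σ a m).PosSemidef := fun m a => by
    classical
    rw [← hρ a, ← Finset.add_sum_erase _ _ (Finset.mem_univ m), add_sub_cancel_left]
    exact posSemidef_sum _ fun m' _ => hσ a m'
  have hSsum : ∑ m, S m = ρ := by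
    simp only [hS]
    rw [Finset.sum_comm]
    simp only [← Finset.smul_sum, hρ]
    rw [← Finset.sum_smul, hp1, one_smul]
  have hStr : ∑ m, (S m).trace.re = ρ.trace.re := by
    rw [← hSsum, trace_sum, Complex.re_sum]
  have hσtr : ∀ a, ∑ m, (σ a m).trace.re = ρ.trace.re := fun a => by
    rw [← hρ a, trace_sum, Complex.re_sum]
  have step := fun m => sq_sum_trace_le hp hp1 (hS ▸ rfl : S m = ∑ a, p a • σ a m)
    (fun a => hσ a m) (hle m) (hWh m) (hW0 m)
  have hK : ∀ m, 0 ≤ ρ.trace.re - (S m).trace.re := fun m => by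
    classical
    rw [← hStr, ← Finset.add_sum_erase _ _ (Finset.mem_univ m), add_sub_cancel_left]
    exact Finset.sum_nonneg fun m' _ => (hSpos m').re_trace_nonneg
  have hV : ∀ m, 0 ≤ ∑ a, p a * (S m * (W m a * W m a)).trace.re := fun m =>
    Finset.sum_nonneg fun a _ => mul_nonneg (hp a) ((hSpos m).re_trace_mul_nonneg (by
      have := posSemidef_conjTranspose_mul_self (W m a)
      rwa [(hWh m a).eq] at this))
  have hCS := Finset.sum_sq_le_sum_mul_sum_of_sq_le_mul Finset.univ (fun m _ => hK m)
    (fun m _ => hV m) (fun m _ => step m)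
  have hKsum : ∑ m, (ρ.trace.re - (S m).trace.re) = ρ.trace.re := by
    rw [Finset.sum_sub_distrib, hStr, Finset.sum_const, Finset.card_univ, hM]
    norm_num
    ring
  rw [hKsum] at hCS
  have hx : ∑ m, ∑ a, p a * (σ a m * W m a).trace.re
      = ∑ i, c i * ∑ a, p a * g i a * ∑ m, (σ a m * B i m).trace.re := by
    have e1 : ∀ m a, (σ a m * W m a).trace.re
        = ∑ i, c i * g i a * ((σ a m * B i m).trace.re - s i * (σ a m).trace.re) := fun m a => by
      simp [hW, hX, Finset.mul_sum, trace_sum, trace_smul, mul_sub, trace_sub]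
    calc ∑ m, ∑ a, p a * (σ a m * W m a).trace.re
        = ∑ i, ∑ a, ∑ m, c i * (p a * g i a *
            ((σ a m * B i m).trace.re - s i * (σ a m).trace.re)) := by
          rw [Finset.sum_comm]
          conv_rhs => rw [Finset.sum_comm]
          refine Finset.sum_congr rfl fun a _ => ?_
          rw [Finset.sum_comm]
          refine Finset.sum_congr rfl fun m _ => ?_
          rw [e1, Finset.mul_sum]
          exact Finset.sum_congr rfl fun i _ => by ring
      _ = ∑ i, (c i * ∑ a, p a * g i a * ∑ m, (σ a m * B i m).trace.re
            - c i * s i * ρ.trace.re * ∑ a, p a * g i a) := by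
          refine Finset.sum_congr rfl fun i _ => ?_
          rw [Finset.mul_sum, Finset.mul_sum, ← Finset.sum_sub_distrib]
          refine Finset.sum_congr rfl fun a _ => ?_
          rw [← Finset.mul_sum, ← Finset.mul_sum, Finset.sum_sub_distrib, ← Finset.mul_sum, hσtr]
          ring
      _ = _ := by simp [hg0]
  have hvar : ∀ m, ∑ a, p a * (S m * (W m a * W m a)).trace.re
      = ∑ i, c i ^ 2 * (S m * (X i m * X i m)).trace.re := fun m => by
    have e1 : ∀ a, (S m * (W m a * W m a)).trace.re = ∑ i, ∑ j,
        c i * c j * (g i a * g j a) * (S m * (X i m * X j m)).trace.re := fun a => by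
      simp only [hW]
      rw [Finset.sum_mul_sum]
      simp only [Finset.mul_sum, trace_sum, smul_mul_assoc,
        mul_smul_comm, trace_smul, Complex.re_sum, Complex.smul_re, smul_eq_mul]
      exact Finset.sum_congr rfl fun i _ => Finset.sum_congr rfl fun j _ => by ring
    calc ∑ a, p a * (S m * (W m a * W m a)).trace.re
        = ∑ i, ∑ j, c i * c j * (S m * (X i m * X j m)).trace.re
            * ∑ a, p a * (g i a * g j a) := by
          simp only [e1, Finset.mul_sum]
          rw [Finset.sum_comm]
          refine Finset.sum_congr rfl fun i _ => ?_
          rw [Finset.sum_comm]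
          exact Finset.sum_congr rfl fun j _ => Finset.sum_congr rfl fun a _ => by ring
      _ = _ := by simp [hg, sq]
  rw [hx] at hCS
  refine hCS.trans (mul_le_mul_of_nonneg_left ?_ ?_)
  · calc ∑ m, ∑ a, p a * (S m * (W m a * W m a)).trace.re
        ≤ ∑ m, ∑ i, c i ^ 2 * ((1 + s i ^ 2) * (S m).trace.re
            - 2 * s i * (S m * B i m).trace.re) := by
          refine Finset.sum_le_sum fun m _ => ?_
          rw [hvar]
          exact Finset.sum_le_sum fun i _ => mul_le_mul_of_nonneg_left
            (re_trace_mul_sub_sq_le (hSpos m) (hB1 i m) _) (sq_nonneg _)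
      _ = ∑ i, c i ^ 2 * ((1 + s i ^ 2) * ∑ m, (S m).trace.re
            - 2 * s i * ∑ m, (S m * B i m).trace.re) := by
          rw [Finset.sum_comm]
          refine Finset.sum_congr rfl fun i _ => ?_
          rw [← Finset.mul_sum, Finset.sum_sub_distrib, ← Finset.mul_sum, ← Finset.mul_sum]
      _ = _ := by
          rw [hStr]
          refine Finset.sum_congr rfl fun i _ => ?_
          have : ∑ m, (S m * B i m).trace.re = ∑ a, p a * ∑ m, (σ a m * B i m).trace.re := by
            simp only [Finset.mul_sum]
            rw [Finset.sum_comm]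
            refine Finset.sum_congr rfl fun m _ => ?_
            rw [← re_trace_sum_smul, hS, Finset.sum_mul]
            simp only [smul_mul_assoc]
          rw [this]
  · rw [← hStr]
    exact Finset.sum_nonneg fun m _ => (hSpos m).re_trace_nonneg

end Matrices

/-! ### From matrices to a pure state on the tensor product -/

section Gram

open Matrix
open scoped ComplexOrder

variable {H : Type*} [NormedAddCommGroup H] [InnerProductSpace ℂ H] {n : ℕ}

/-- The matrix of the sesquilinear form `⟪·, T ·⟫` on a finite family of vectors. -/
noncomputable def formMatrix (v : Fin n → H) (T : H →L[ℂ] H) : Matrix (Fin n) (Fin n) ℂ :=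
  Matrix.of fun j l => inner ℂ (v j) (T (v l))

lemma formMatrix_add (v : Fin n → H) (T U : H →L[ℂ] H) :
    formMatrix v (T + U) = formMatrix v T + formMatrix v U := by
  ext; simp [formMatrix]

lemma formMatrix_sub (v : Fin n → H) (T U : H →L[ℂ] H) :
    formMatrix v (T - U) = formMatrix v T - formMatrix v U := by
  ext; simp [formMatrix]

lemma formMatrix_one {v : Fin n → H} (hv : Orthonormal ℂ v) : formMatrix v 1 = 1 := by
  ext j l
  simp [formMatrix, orthonormal_iff_ite.1 hv, Matrix.one_apply]

lemma formMatrix_posSemidef (v : Fin n → H) {T : H →L[ℂ] H} (hT : T.IsPositive) :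
    (formMatrix v T).PosSemidef := by
  refine PosSemidef.of_dotProduct_mulVec_nonneg ?_ fun w => ?_
  · ext j l
    simp only [formMatrix, conjTranspose_apply, of_apply, RCLike.star_def, inner_conj_symm]
    exact hT.inner_left_eq_inner_right _ _
  · have := hT.inner_nonneg_right (∑ j, w j • v j)
    convert this using 1
    simp only [formMatrix, dotProduct, mulVec, of_apply, Pi.star_apply, map_sum, map_smul,
      sum_inner, inner_sum, inner_smul_left, inner_smul_right, Finset.mul_sum, RCLike.star_def]
    rw [Finset.sum_comm]
    exact Finset.sum_congr rfl fun j _ => Finset.sum_congr rfl fun l _ => by ring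

end Gram

lemma sum_int_units {M : Type*} [AddCommMonoid M] (f : ℤˣ → M) : ∑ m, f m = f 1 + f (-1) := by
  rw [UnitsInt.univ, Finset.sum_pair (by decide)]

section Tensor

open scoped ComplexOrder

variable {HA HB : Type*} [NormedAddCommGroup HA] [InnerProductSpace ℂ HA]
  [NormedAddCommGroup HB] [InnerProductSpace ℂ HB]

/-- Every algebraic tensor lies in `HA ⊗ V` for a finite-dimensional `V`; its coefficients are read
off in an orthonormal basis of `V`. -/
lemma TensorProduct.exists_eq_sum_orthonormal (t : HA ⊗[ℂ] HB) :
    ∃ (n : ℕ) (x : Fin n → HA) (y : Fin n → HB), Orthonormal ℂ y ∧ t = ∑ j, x j ⊗ₜ[ℂ] y j := by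
  obtain ⟨V, hV, ht⟩ := TensorProduct.exists_finite_submodule_right_of_setFinite {t}
    (Set.finite_singleton t)
  obtain ⟨u, rfl⟩ := ht rfl
  let b := stdOrthonormalBasis ℂ V
  suffices h : ∃ x : Fin (Module.finrank ℂ V) → HA, u = ∑ j, x j ⊗ₜ[ℂ] b j by
    obtain ⟨x, rfl⟩ := h
    refine ⟨_, x, fun j => (b j : HB), b.orthonormal.comp_linearIsometry V.subtypeₗᵢ, ?_⟩
    simp
  clear ht
  induction u using TensorProduct.induction_on with
  | zero => exact ⟨0, by simp⟩
  | tmul x y =>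
    refine ⟨fun j => (inner ℂ (b j) y : ℂ) • x, ?_⟩
    conv_lhs => rw [← b.sum_repr' y, TensorProduct.tmul_sum]
    exact Finset.sum_congr rfl fun j _ => by rw [TensorProduct.tmul_smul, TensorProduct.smul_tmul']
  | add u v hu hv =>
    obtain ⟨x, rfl⟩ := hu
    obtain ⟨x', rfl⟩ := hv
    exact ⟨x + x', by simp [TensorProduct.add_tmul, Finset.sum_add_distrib]⟩

/-- The expectation value of `E ⊗ F` in the (not necessarily normalized) vector state `ψ`. -/
noncomputable def expect (ψ : HTensor HA HB) (E : HA →L[ℂ] HA) (F : HB →L[ℂ] HB) : ℝ :=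
  (inner ℂ ψ (tensorOp E F ψ)).re

lemma continuous_expect (E : HA →L[ℂ] HA) (F : HB →L[ℂ] HB) :
    Continuous fun ψ : HTensor HA HB => expect ψ E F := by
  unfold expect
  exact Complex.continuous_re.comp (continuous_id.inner (tensorOp E F).continuous)

/-- When `y` is orthonormal, `(formMatrix x E)ᵀ` is the matrix of the unnormalized state in which the
effect `E` leaves Bob. -/
lemma expect_sum_tmul {n : ℕ} (x : Fin n → HA) (y : Fin n → HB) (E : HA →L[ℂ] HA)
    (F : HB →L[ℂ] HB) :
    expect ((∑ j, x j ⊗ₜ[ℂ] y j : HA ⊗[ℂ] HB) : HTensor HA HB) E F =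
      ((formMatrix x E).transpose * formMatrix y F).trace.re := by
  rw [expect, tensorOp, ContinuousLinearMap.completion_apply_coe, UniformSpace.Completion.inner_coe]
  congr 1
  simp only [map_sum, TensorProduct.mapL_tmul, sum_inner, inner_sum, TensorProduct.inner_tmul,
    Matrix.trace, Matrix.diag, Matrix.mul_apply, Matrix.transpose_apply, formMatrix, Matrix.of_apply]

lemma expect_one_one (ψ : HTensor HA HB) : expect ψ 1 1 = ‖ψ‖ ^ 2 := by
  have h : tensorOp (1 : HA →L[ℂ] HA) (1 : HB →L[ℂ] HB) = 1 := by
    ext ψ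
    induction ψ using UniformSpace.Completion.induction_on with
    | hp => exact isClosed_eq (ContinuousLinearMap.continuous _) continuous_id
    | ih t =>
      rw [tensorOp, ContinuousLinearMap.completion_apply_coe]
      simp
  rw [expect, h]
  exact inner_self_eq_norm_sq (𝕜 := ℂ) ψ

lemma QMeasurement.effect_one_add_effect_neg_one {H : Type*} [NormedAddCommGroup H]
    [InnerProductSpace ℂ H] (m : QMeasurement ℤˣ H) : m.effect 1 + m.effect (-1) = 1 := by
  rw [← sum_int_units, m.sum_effect]

/-- The observable `F₊ - F₋` of a measurement with outcomes `±1`, whose expectation value is that of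
the outcome. Its square is `1` only if the measurement is projective. -/
def QMeasurement.observable {H : Type*} [NormedAddCommGroup H]
    [InnerProductSpace ℂ H] (m : QMeasurement ℤˣ H) : H →L[ℂ] H :=
  m.effect 1 - m.effect (-1)

lemma expect_sub (ψ : HTensor HA HB) (E : HA →L[ℂ] HA) (F G : HB →L[ℂ] HB) :
    expect ψ E (F - G) = expect ψ E F - expect ψ E G := by
  induction ψ using UniformSpace.Completion.induction_on with
  | hp => exact isClosed_eq (continuous_expect _ _) ((continuous_expect _ _).sub
      (continuous_expect _ _))
  | ih t =>
    obtain ⟨n, x, y, -, rfl⟩ := TensorProduct.exists_eq_sum_orthonormal t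
    simp only [expect_sum_tmul, formMatrix_sub, mul_sub, Matrix.trace_sub, Complex.sub_re]

variable {A ι : Type*} [Fintype A] [Fintype ι] [DecidableEq ι]

/-- The covariance inequality in a vector state. Both sides are continuous in `ψ`, and for algebraic
tensors it is the matrix inequality `sq_sum_cov_le`. -/
lemma sq_sum_cov_expect_le {p : A → ℝ} (hp : ∀ a, 0 ≤ p a) (hp1 : ∑ a, p a = 1)
    {g : ι → A → ℝ} (hg0 : ∀ i, ∑ a, p a * g i a = 0)
    (hg : ∀ i j, ∑ a, p a * (g i a * g j a) = if i = j then 1 else 0)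
    (alice : A → QMeasurement ℤˣ HA) (bob : ι → ℤˣ → QMeasurement ℤˣ HB) (c s : ι → ℝ)
    (ψ : HTensor HA HB) :
    (∑ i, c i * ∑ a, p a * g i a *
        ∑ m, expect ψ ((alice a).effect m) (bob i m).observable) ^ 2 ≤
      ‖ψ‖ ^ 2 * ∑ i, c i ^ 2 * ((1 + s i ^ 2) * ‖ψ‖ ^ 2
        - 2 * s i * ∑ a, p a * ∑ m, expect ψ ((alice a).effect m) (bob i m).observable) := by
  have hc := fun E F => continuous_expect (HA := HA) (HB := HB) E F
  induction ψ using UniformSpace.Completion.induction_on with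
  | hp =>
    refine isClosed_le ?_ ?_
    · refine (continuous_finsetSum _ fun i _ => continuous_const.mul
        (continuous_finsetSum _ fun a _ => continuous_const.mul
          (continuous_finsetSum _ fun m _ => hc _ _))).pow 2
    · refine (continuous_norm.pow 2).mul (continuous_finsetSum _ fun i _ => continuous_const.mul
        ((continuous_const.mul (continuous_norm.pow 2)).sub (continuous_const.mul
        (continuous_finsetSum _ fun a _ => continuous_const.mul
          (continuous_finsetSum _ fun m _ => hc _ _)))))
  | ih t =>
    obtain ⟨n, x, y, hy, rfl⟩ := TensorProduct.exists_eq_sum_orthonormal t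
    have h1 := formMatrix_one hy
    have hsum : ∀ i m, formMatrix y ((bob i m).effect 1)
        + formMatrix y ((bob i m).effect (-1)) = 1 :=
      fun i m => by rw [← formMatrix_add, QMeasurement.effect_one_add_effect_neg_one, h1]
    have hps := fun i m k => formMatrix_posSemidef y ((bob i m).isPositive k)
    have hnorm : ((formMatrix x 1).transpose).trace.re
        = ‖((∑ j, x j ⊗ₜ[ℂ] y j : HA ⊗[ℂ] HB) : HTensor HA HB)‖ ^ 2 := by
      rw [← expect_one_one, expect_sum_tmul, h1, mul_one]
    have := sq_sum_cov_le hp hp1 hg0 hg (by simp : Fintype.card ℤˣ = 2)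
      (σ := fun a m => (formMatrix x ((alice a).effect m)).transpose)
      (ρ := (formMatrix x 1).transpose)
      (fun a m => (formMatrix_posSemidef x ((alice a).isPositive m)).transpose)
      (fun a => by
        rw [← (alice a).effect_one_add_effect_neg_one, formMatrix_add, Matrix.transpose_add]
        exact sum_int_units _)
      (B := fun i m => formMatrix y (bob i m).observable)
      (fun i m => by
        rw [QMeasurement.observable, formMatrix_sub]
        exact (hps i m 1).isHermitian.sub (hps i m (-1)).isHermitian)
      (fun i m => by
        rw [QMeasurement.observable, formMatrix_sub]
        exact one_sub_sq_posSemidef_of_add_eq_one (hps i m 1) (hps i m (-1)) (hsum i m))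
      c s
    simpa only [hnorm, ← expect_sum_tmul] using this

end Tensor

/-! ### Mutual information of two bits -/

lemma mutualInfo_column_le {u e : ℝ} (h1 : 0 ≤ u + e) (h2 : 0 ≤ u - e) :
    (u + e) / 4 * Real.logb 2 ((u + e) / 4 / (1 / 2 * (u / 2))) +
      (u - e) / 4 * Real.logb 2 ((u - e) / 4 / (1 / 2 * (u / 2))) ≤ e ^ 2 / (2 * u) := by
  have hu : 0 ≤ u := by linarith
  rcases hu.eq_or_lt with rfl | hu
  · obtain rfl : e = 0 := by linarith
    simp
  · have e1 : (u + e) / 4 / (1 / 2 * (u / 2)) = 1 + e / u := by field_simp; ring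
    have e2 : (u - e) / 4 / (1 / 2 * (u / 2)) = 1 - e / u := by field_simp; ring
    have hx : |e / u| ≤ 1 := by
      rw [abs_div, abs_of_pos hu, div_le_one hu, abs_le]
      constructor <;> linarith
    have := mul_le_mul_of_nonneg_left (mul_logb_add_mul_logb_le hx)
      (by positivity : 0 ≤ u / 4)
    rw [e1, e2]
    have e3 : u / 4 * (2 * (e / u) ^ 2) = e ^ 2 / (2 * u) := by field_simp; ring
    have e4 : u + e = u * (1 + e / u) := by field_simp
    have e5 : u - e = u * (1 - e / u) := by field_simp
    rw [e3] at this
    rw [e4, e5]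
    linarith

/-- The mutual information of a uniform bit `α` and a bit `β` is at most the square of their
correlation coefficient, `d² / (1 - S²)` with `S = E β` and `d = E αβ`. If `S = ±1`, then `β` is
constant, `d = 0`, and the quotient has the right value `0`. -/
lemma mutualInfo_le_sq_div {P : ℤˣ → ℤˣ → ℝ} {S d : ℝ}
    (hP : ∀ α β : ℤˣ, P α β = (1 + ((β : ℤ) : ℝ) * S + ((α : ℤ) : ℝ) * ((β : ℤ) : ℝ) * d) / 4)
    (hpos : ∀ α β, 0 ≤ P α β) : mutualInfo P ≤ d ^ 2 / (1 - S ^ 2) := by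
  have hp1 := hpos 1 1
  have hp2 := hpos 1 (-1)
  have hp3 := hpos (-1) 1
  have hp4 := hpos (-1) (-1)
  simp only [hP] at hp1 hp2 hp3 hp4
  norm_num at hp1 hp2 hp3 hp4
  have c1 := mutualInfo_column_le (u := 1 + S) (e := d) (by linarith) (by linarith)
  have c2 := mutualInfo_column_le (u := 1 - S) (e := d) (by linarith) (by linarith)
  have hI : mutualInfo P =
      ((1 + S + d) / 4 * Real.logb 2 ((1 + S + d) / 4 / (1 / 2 * ((1 + S) / 2))) +
      (1 + S - d) / 4 * Real.logb 2 ((1 + S - d) / 4 / (1 / 2 * ((1 + S) / 2)))) +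
      ((1 - S + d) / 4 * Real.logb 2 ((1 - S + d) / 4 / (1 / 2 * ((1 - S) / 2))) +
      (1 - S - d) / 4 * Real.logb 2 ((1 - S - d) / 4 / (1 / 2 * ((1 - S) / 2)))) := by
    have p1 : P 1 1 = (1 + S + d) / 4 := by rw [hP]; norm_num
    have p2 : P 1 (-1) = (1 - S - d) / 4 := by rw [hP]; norm_num; ring
    have p3 : P (-1) 1 = (1 + S - d) / 4 := by rw [hP]; norm_num; ring
    have p4 : P (-1) (-1) = (1 - S + d) / 4 := by rw [hP]; norm_num; ring
    have r1 : (1 + S + d) / 4 + (1 - S - d) / 4 = 1 / 2 := by ring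
    have r2 : (1 + S - d) / 4 + (1 - S + d) / 4 = 1 / 2 := by ring
    have r3 : (1 + S + d) / 4 + (1 + S - d) / 4 = (1 + S) / 2 := by ring
    have r4 : (1 - S - d) / 4 + (1 - S + d) / 4 = (1 - S) / 2 := by ring
    simp only [mutualInfo, sum_int_units, p1, p2, p3, p4, r1, r2, r3, r4]
    ring
  rw [hI]
  refine (add_le_add c1 c2).trans (le_of_eq ?_)
  -- a value of `β` that has probability zero forces `d = 0`
  rcases (by linarith : 0 ≤ 1 + S).eq_or_lt with h | h
  · obtain rfl : d = 0 := by linarith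
    simp
  rcases (by linarith : 0 ≤ 1 - S).eq_or_lt with h' | h'
  · obtain rfl : d = 0 := by linarith
    simp
  have e : 1 - S ^ 2 = (1 + S) * (1 - S) := by ring
  rw [e]
  field_simp
  ring

/-! ### Statistics of a protocol -/

section Prob

variable {HA HB : Type*} [NormedAddCommGroup HA] [InnerProductSpace ℂ HA]
  [NormedAddCommGroup HB] [InnerProductSpace ℂ HB]

lemma expect_add_left (ψ : HTensor HA HB) (E E' : HA →L[ℂ] HA) (F : HB →L[ℂ] HB) :
    expect ψ (E + E') F = expect ψ E F + expect ψ E' F := by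
  induction ψ using UniformSpace.Completion.induction_on with
  | hp => exact isClosed_eq (continuous_expect _ _) ((continuous_expect _ _).add
      (continuous_expect _ _))
  | ih t =>
    obtain ⟨n, x, y, -, rfl⟩ := TensorProduct.exists_eq_sum_orthonormal t
    simp only [expect_sum_tmul, formMatrix_add, Matrix.transpose_add, add_mul, Matrix.trace_add,
      Complex.add_re]

lemma expect_nonneg (ψ : HTensor HA HB) {E : HA →L[ℂ] HA} {F : HB →L[ℂ] HB}
    (hE : E.IsPositive) (hF : F.IsPositive) : 0 ≤ expect ψ E F := by
  induction ψ using UniformSpace.Completion.induction_on with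
  | hp => exact isClosed_le continuous_const (continuous_expect _ _)
  | ih t =>
    obtain ⟨n, x, y, -, rfl⟩ := TensorProduct.exists_eq_sum_orthonormal t
    rw [expect_sum_tmul]
    open scoped ComplexOrder in
    exact (formMatrix_posSemidef x hE).transpose.re_trace_mul_nonneg (formMatrix_posSemidef y hF)

lemma BipartiteState.hasSum_expect (ρ : BipartiteState HA HB) (E : HA →L[ℂ] HA)
    (F : HB →L[ℂ] HB) : HasSum (fun k => expect (ρ.vec k) E F) (ρ.prob E F) := by
  refine (Summable.of_norm_bounded (ρ.hasSum_norm_sq.summable.mul_left ‖tensorOp E F‖)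
    fun k => ?_).hasSum
  rw [Real.norm_eq_abs]
  calc |expect (ρ.vec k) E F| ≤ ‖inner ℂ (ρ.vec k) (tensorOp E F (ρ.vec k))‖ :=
        Complex.abs_re_le_norm _
    _ ≤ ‖ρ.vec k‖ * (‖tensorOp E F‖ * ‖ρ.vec k‖) :=
        (norm_inner_le_norm _ _).trans (by gcongr; exact ContinuousLinearMap.le_opNorm _ _)
    _ = _ := by ring

lemma BipartiteState.prob_add_left (ρ : BipartiteState HA HB) (E E' : HA →L[ℂ] HA)
    (F : HB →L[ℂ] HB) : ρ.prob (E + E') F = ρ.prob E F + ρ.prob E' F := by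
  refine (ρ.hasSum_expect _ _).unique ?_
  simpa only [expect_add_left] using (ρ.hasSum_expect E F).add (ρ.hasSum_expect E' F)

lemma BipartiteState.prob_sub_right (ρ : BipartiteState HA HB) (E : HA →L[ℂ] HA)
    (F F' : HB →L[ℂ] HB) : ρ.prob E (F - F') = ρ.prob E F - ρ.prob E F' := by
  refine (ρ.hasSum_expect _ _).unique ?_
  simpa only [expect_sub] using (ρ.hasSum_expect E F).sub (ρ.hasSum_expect E F')

lemma BipartiteState.prob_one_one (ρ : BipartiteState HA HB) : ρ.prob 1 1 = 1 := by
  refine (ρ.hasSum_expect _ _).unique ?_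
  simpa only [expect_one_one] using ρ.hasSum_norm_sq

lemma BipartiteState.prob_nonneg (ρ : BipartiteState HA HB) {E : HA →L[ℂ] HA}
    {F : HB →L[ℂ] HB} (hE : E.IsPositive) (hF : F.IsPositive) : 0 ≤ ρ.prob E F :=
  tsum_nonneg fun _ => expect_nonneg _ hE hF

/-- The Cauchy-Schwarz inequality for series, with bounds on the squares of the terms. -/
lemma sq_le_mul_of_hasSum {x t v : ℕ → ℝ} {X T V : ℝ} (hx : HasSum x X) (ht : HasSum t T)
    (hv : HasSum v V) (ht0 : ∀ k, 0 ≤ t k) (hv0 : ∀ k, 0 ≤ v k)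
    (h : ∀ k, x k ^ 2 ≤ t k * v k) : X ^ 2 ≤ T * V :=
  le_of_tendsto_of_tendsto' (hx.tendsto_sum_nat.pow 2)
    (ht.tendsto_sum_nat.mul hv.tendsto_sum_nat) fun _ =>
      Finset.sum_sq_le_sum_mul_sum_of_sq_le_mul _ (fun k _ => ht0 k) (fun k _ => hv0 k)
        fun k _ => h k

variable {A ι : Type*} [Fintype A] [Fintype ι] [DecidableEq ι]

/-- The covariance inequality in a mixed state. -/
lemma BipartiteState.sq_sum_cov_prob_le (ρ : BipartiteState HA HB) {p : A → ℝ}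
    (hp : ∀ a, 0 ≤ p a) (hp1 : ∑ a, p a = 1)
    {g : ι → A → ℝ} (hg0 : ∀ i, ∑ a, p a * g i a = 0)
    (hg : ∀ i j, ∑ a, p a * (g i a * g j a) = if i = j then 1 else 0)
    (alice : A → QMeasurement ℤˣ HA) (bob : ι → ℤˣ → QMeasurement ℤˣ HB) (c s : ι → ℝ) :
    (∑ i, c i * ∑ a, p a * g i a *
        ∑ m, ρ.prob ((alice a).effect m) (bob i m).observable) ^ 2 ≤
      ∑ i, c i ^ 2 * ((1 + s i ^ 2)
        - 2 * s i * ∑ a, p a * ∑ m, ρ.prob ((alice a).effect m) (bob i m).observable) := by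
  have hs := fun E F => ρ.hasSum_expect E F
  have hx : HasSum (fun k => ∑ i, c i * ∑ a, p a * g i a *
      ∑ m, expect (ρ.vec k) ((alice a).effect m) (bob i m).observable) _ :=
    hasSum_sum fun i _ => (hasSum_sum fun a _ => (hasSum_sum fun m _ =>
      hs ((alice a).effect m) (bob i m).observable).mul_left (p a * g i a)).mul_left (c i)
  have hv : HasSum (fun k => ∑ i, c i ^ 2 * ((1 + s i ^ 2) * ‖ρ.vec k‖ ^ 2
      - 2 * s i * ∑ a, p a *
        ∑ m, expect (ρ.vec k) ((alice a).effect m) (bob i m).observable)) _ :=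
    hasSum_sum fun i _ => ((ρ.hasSum_norm_sq.mul_left (1 + s i ^ 2)).sub
      ((hasSum_sum fun a _ => (hasSum_sum fun m _ =>
      hs ((alice a).effect m) (bob i m).observable).mul_left (p a)).mul_left (2 * s i))).mul_left
      (c i ^ 2)
  have hle := fun k => sq_sum_cov_expect_le hp hp1 hg0 hg alice bob c s (ρ.vec k)
  have := sq_le_mul_of_hasSum hx ρ.hasSum_norm_sq hv (fun k => sq_nonneg _) (fun k => ?_) hle
  · simpa only [mul_one, one_mul] using this
  · rcases eq_or_ne (ρ.vec k) 0 with h0 | h0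
    · simp [h0, expect]
    · exact nonneg_of_mul_nonneg_right ((sq_nonneg _).trans (hle k)) (by positivity)

end Prob

namespace OneBitProtocol

variable {N : ℕ} {HA HB : Type*} [NormedAddCommGroup HA] [InnerProductSpace ℂ HA]
  [NormedAddCommGroup HB] [InnerProductSpace ℂ HB]

lemma guessProb_nonneg (π : OneBitProtocol N HA HB) (a : Fin N → ℤˣ) (i : Fin N) (β : ℤˣ) :
    0 ≤ π.guessProb a i β :=
  Finset.sum_nonneg fun _ _ => π.state.prob_nonneg ((π.alice a).isPositive _)
    ((π.bob i _).isPositive _)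

lemma guessProb_one_sub (π : OneBitProtocol N HA HB) (a : Fin N → ℤˣ) (i : Fin N) :
    π.guessProb a i 1 - π.guessProb a i (-1) =
      ∑ m, π.state.prob ((π.alice a).effect m) (π.bob i m).observable := by
  simp only [guessProb, QMeasurement.observable, BipartiteState.prob_sub_right,
    Finset.sum_sub_distrib]

lemma guessProb_one_add (π : OneBitProtocol N HA HB) (a : Fin N → ℤˣ) (i : Fin N) :
    π.guessProb a i 1 + π.guessProb a i (-1) = 1 := by
  have h : ∀ m, π.state.prob ((π.alice a).effect m) ((π.bob i m).effect 1)
      + π.state.prob ((π.alice a).effect m) ((π.bob i m).effect (-1))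
      = π.state.prob ((π.alice a).effect m) 1 := fun m => by
    rw [eq_sub_of_add_eq (π.bob i m).effect_one_add_effect_neg_one,
      BipartiteState.prob_sub_right, sub_add_cancel]
  rw [guessProb, guessProb, ← Finset.sum_add_distrib]
  simp only [h]
  rw [sum_int_units, ← BipartiteState.prob_add_left, QMeasurement.effect_one_add_effect_neg_one,
    BipartiteState.prob_one_one]

end OneBitProtocol

/-! ### Pairwise independent uniform bits form an orthonormal system -/

section Bits

variable {N : ℕ} {p : (Fin N → ℤˣ) → ℝ}

lemma UniformBits.sum_mul_bit_eq_zero (h : UniformBits p) (i : Fin N) :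
    ∑ a, p a * ((a i : ℤ) : ℝ) = 0 := by
  have e : ∀ a, p a * ((a i : ℤ) : ℝ) =
      (if a i = 1 then p a else 0) - (if a i = -1 then p a else 0) := fun a => by
    rcases Int.units_eq_one_or (a i) with h | h <;> simp [h]
  have h1 := h i 1
  have h2 := h i (-1)
  unfold eventProb at h1 h2
  rw [Finset.sum_congr rfl fun a _ => e a, Finset.sum_sub_distrib, h1, h2, sub_self]

lemma PairwiseIndepBits.sum_mul_bit_mul_bit (h : PairwiseIndepBits p) (hu : UniformBits p)
    (hp1 : ∑ a, p a = 1) (i j : Fin N) :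
    ∑ a, p a * (((a i : ℤ) : ℝ) * ((a j : ℤ) : ℝ)) = if i = j then 1 else 0 := by
  split_ifs with hij
  · subst hij
    rw [← hp1]
    refine Finset.sum_congr rfl fun a _ => ?_
    rcases Int.units_eq_one_or (a i) with h | h <;> simp [h]
  · have e : ∀ a, p a * (((a i : ℤ) : ℝ) * ((a j : ℤ) : ℝ)) =
        (if a i = 1 ∧ a j = 1 then p a else 0) - (if a i = 1 ∧ a j = -1 then p a else 0)
        - ((if a i = -1 ∧ a j = 1 then p a else 0)
          - (if a i = -1 ∧ a j = -1 then p a else 0)) := fun a => by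
      rcases Int.units_eq_one_or (a i) with h | h <;>
        rcases Int.units_eq_one_or (a j) with h' | h' <;> simp [h, h']
    have h1 := h i j hij 1 1
    have h2 := h i j hij 1 (-1)
    have h3 := h i j hij (-1) 1
    have h4 := h i j hij (-1) (-1)
    rw [hu, hu] at h1 h2 h3 h4
    unfold eventProb at h1 h2 h3 h4
    rw [Finset.sum_congr rfl fun a _ => e a]
    simp only [Finset.sum_sub_distrib]
    rw [h1, h2, h3, h4]
    ring

end Bits

lemma OneBitProtocol.jointDist_eq {N : ℕ} {HA HB : Type*} [NormedAddCommGroup HA]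
    [InnerProductSpace ℂ HA] [NormedAddCommGroup HB] [InnerProductSpace ℂ HB]
    {p : (Fin N → ℤˣ) → ℝ} (hp1 : ∑ a, p a = 1) (hu : UniformBits p)
    (π : OneBitProtocol N HA HB) (i : Fin N) (α β : ℤˣ) :
    π.jointDist p i α β = (1
      + ((β : ℤ) : ℝ) * ∑ a, p a * (π.guessProb a i 1 - π.guessProb a i (-1))
      + ((α : ℤ) : ℝ) * ((β : ℤ) : ℝ) *
        ∑ a, p a * ((a i : ℤ) : ℝ) * (π.guessProb a i 1 - π.guessProb a i (-1))) / 4 := by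
  have e : ∀ a, (if a i = α then p a * π.guessProb a i β else 0) =
      (p a + ((α : ℤ) : ℝ) * (p a * ((a i : ℤ) : ℝ))
      + ((β : ℤ) : ℝ) * (p a * (π.guessProb a i 1 - π.guessProb a i (-1)))
      + ((α : ℤ) : ℝ) * ((β : ℤ) : ℝ) *
        (p a * ((a i : ℤ) : ℝ) * (π.guessProb a i 1 - π.guessProb a i (-1)))) / 4 := fun a => by
    have h1 := eq_sub_of_add_eq (π.guessProb_one_add a i)
    rcases Int.units_eq_one_or (a i) with h | h <;> rcases Int.units_eq_one_or α with h' | h' <;>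
      rcases Int.units_eq_one_or β with h'' | h'' <;> subst h' <;> subst h'' <;>
      rw [h] <;> norm_num [h1] <;> ring
  rw [OneBitProtocol.jointDist, Finset.sum_congr rfl fun a _ => e a, ← Finset.sum_div]
  simp only [Finset.sum_add_distrib, ← Finset.mul_sum]
  rw [hp1, hu.sum_mul_bit_eq_zero i]
  ring

/-! ### The sum of the mutual informations -/

theorem theorem3 {N : ℕ} {HA HB : Type*}
    [NormedAddCommGroup HA] [InnerProductSpace ℂ HA] [CompleteSpace HA]
    [NormedAddCommGroup HB] [InnerProductSpace ℂ HB] [CompleteSpace HB]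
    (p : (Fin N → ℤˣ) → ℝ) (hp : p ∈ stdSimplex ℝ (Fin N → ℤˣ))
    (huniform : UniformBits p) (hindep : PairwiseIndepBits p)
    (π : OneBitProtocol N HA HB) :
    ∑ i : Fin N, mutualInfo (π.jointDist p i) ≤ 1 := by
  obtain ⟨hp0, hp1⟩ := hp
  set S : Fin N → ℝ := fun i => ∑ a, p a * (π.guessProb a i 1 - π.guessProb a i (-1)) with hS
  set d : Fin N → ℝ := fun i =>
    ∑ a, p a * ((a i : ℤ) : ℝ) * (π.guessProb a i 1 - π.guessProb a i (-1)) with hd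
  have hI : ∀ i, mutualInfo (π.jointDist p i) ≤ d i ^ 2 / (1 - S i ^ 2) := fun i =>
    mutualInfo_le_sq_div (π.jointDist_eq hp1 huniform i) fun α β =>
      Finset.sum_nonneg fun a _ => by
        split_ifs
        · exact mul_nonneg (hp0 a) (π.guessProb_nonneg a i β)
        · exact le_rfl
  refine (Finset.sum_le_sum fun i _ => hI i).trans ?_
  -- with the weights `d i / (1 - S i ^ 2)` the covariance inequality reads `D ^ 2 ≤ D`
  have hcov := π.state.sq_sum_cov_prob_le hp0 hp1 (g := fun i a => ((a i : ℤ) : ℝ))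
    huniform.sum_mul_bit_eq_zero (hindep.sum_mul_bit_mul_bit huniform hp1) π.alice π.bob
    (fun i => d i / (1 - S i ^ 2)) S
  simp only [← OneBitProtocol.guessProb_one_sub] at hcov
  have e1 : ∀ i, d i / (1 - S i ^ 2) * d i = d i ^ 2 / (1 - S i ^ 2) := fun i => by ring
  have e2 : ∀ i, (d i / (1 - S i ^ 2)) ^ 2 * (1 + S i ^ 2 - 2 * S i * S i)
      = d i ^ 2 / (1 - S i ^ 2) := fun i => by
    rcases eq_or_ne (1 - S i ^ 2) 0 with h | h
    · simp [h]
    · field_simp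
      ring
  have hD : (∑ i, d i ^ 2 / (1 - S i ^ 2)) ^ 2 ≤ ∑ i, d i ^ 2 / (1 - S i ^ 2) := by
    rw [← Finset.sum_congr rfl fun i _ => e1 i]
    refine hcov.trans (le_of_eq ?_)
    exact Finset.sum_congr rfl fun i _ => (e2 i).trans (e1 i).symm
  by_contra! h
  nlinarith
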